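/- Let $d,n\ge 1$, $0\le t\le n$, $m\ge 0$ be integers and $N=d^n$. The $d$-ary inverse Banyan plane $\mathrm{BY}^{-1}(n)$ has inputs and outputs labelled by the strings in $\mathbb Z_d^n$ and $n$ stages of $d\times d$ switching elements (SEs), each stage labelled by $\mathbb Z_d^{n-1}$; input $x_1\cdots x_n$ is attached to the SE $x_1\cdots x_{n-1}$ of stage $1$, output $y_1\cdots y_n$ to the SE $y_1\cdots y_{n-1}$ of stage $n$, and the SE $z$ of stage $i\le n-1$ is connected to the $d$ SEs $z_1\cdots z_{i-1}*z_{i+1}\cdots z_{n-1}$, $*\in\mathbb Z_d$, of stage $i+1$. Hence the unique route $R(x,y)$ from $x$ to $y$ passes in stage $j$ through the SE $y_1\cdots y_{j-1}x_j\cdots x_{n-1}$. The network $\log_d(N,0,m)$ consists of $m$ such planes stacked in parallel; each input and each output is attached to all planes, and an input may send into several planes. A (multicast) request $(a,B)$ consists of a free input $a$ and a nonempty set $B$ of free outputs, with no restriction on $|B|$; it is realized by choosing for each $b\in B$ a plane carrying $R(a,b)$. A state of the network is crosstalk-free if no two routes on the same plane that belong to different requests share an SE. The window algorithm with window size $d^t$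 partitions the outputs into $d^{n-t}$ windows, each consisting of all outputs sharing a given prefix of length $n-t$, and requires that for each window $W$ all routes from $a$ to $B\cap W$ use one and the same plane; the choice of planes is otherwise arbitrary. The network is crosstalk-free wide-sense nonblocking under this algorithm if, in every state that can arise from the idle network by successively realizing requests according to the algorithm without crosstalk and releasing existing requests, every new request can be realized according to the algorithm without crosstalk and without disturbing existing connections. Theorem. $\log_d(N,0,m)$ is crosstalk-free wide-sense nonblocking under the window algorithm with window size $d^t$ if $$m\ \ge\ \begin{cases} d^{\,n-2t}+t\,d^{\,n-t}(d-1), & t<n/2,\\ d^{\,n-t}\bigl[(n-t)(d-1)-1\bigr]+d^t+1, & t=n/2,\\ d^{\,n-t}\bigl[(n-t)(d-1)-1\bigr]+d^t-d^{\,2t-n-2}(d-1)+1, & t>n/2,\end{cases}$$ where for $2t=n+1$ the power $d^{\,2t-n-2}$ means $1/d$. -/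

import Mathlib

namespace Multilog

/-- `d`-ary strings of length `l`; inputs and outputs of the network are `Word d n`. -/
abbrev Word (d l : ℕ) : Type := Fin l → Fin d

/-- The prefix of length `l - k` of a string of length `l`. -/
def dropLast {d l : ℕ} (k : ℕ) (x : Word d l) : Word d (l - k) :=
  fun i => x (Fin.castLE (Nat.sub_le l k) i)

/-! ### The inverse Banyan plane

It has `n` stages (numbered `0, …, n - 1` here), and the `d × d` switching elements of each stage
are labelled by `Word d (n - 1)`. -/

/-- The switching element `z` of stage `j` is connected to the switching element `z'` of
stage `j + 1`: the labels agree except possibly in the symbol with (0-based) index `j`. -/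
def Linked {d n : ℕ} (j : ℕ) (z z' : Word d (n - 1)) : Prop :=
  ∀ i : Fin (n - 1), i.val ≠ j → z i = z' i

/-- `P j` (for the stages `j`) are the switching elements of a path through the plane from
input `x` to output `y`. -/
structure IsPath {d n : ℕ} (x y : Word d n) (P : Fin n → Word d (n - 1)) : Prop where
  first : ∀ h : 0 < n, P ⟨0, h⟩ = dropLast 1 x
  step : ∀ (j : ℕ) (h : j + 1 < n), Linked j (P ⟨j, Nat.lt_of_succ_lt h⟩) (P ⟨j + 1, h⟩)
  last : ∀ h : 0 < n, P ⟨n - 1, Nat.sub_lt h Nat.one_pos⟩ = dropLast 1 y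

/-- The route `R(x, y)`: its switching element in stage `j` is labelled by the first `j` symbols
of `y` followed by the symbols `j, …, n - 2` of `x` (0-based). -/
def route {d n : ℕ} (x y : Word d n) (j : Fin n) : Word d (n - 1) :=
  fun i => if i.val < j.val then dropLast 1 y i else dropLast 1 x i

/-- `route x y` is the unique path from `x` to `y` in the plane. -/
theorem isPath_iff {d n : ℕ} (x y : Word d n) (P : Fin n → Word d (n - 1)) :
    IsPath x y P ↔ P = route x y := by
  constructor
  · intro hP
    have up : ∀ (i : Fin (n - 1)) (j : ℕ) (h : j < n), j ≤ i.val →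
        P ⟨j, h⟩ i = dropLast 1 x i := by
      intro i j
      induction j with
      | zero => intro h _; rw [hP.first h]
      | succ j ih =>
        intro h hj
        rw [← hP.step j h i (by omega)]
        exact ih _ (by omega)
    have down : ∀ (i : Fin (n - 1)) (k : ℕ) (h : n - 1 - k < n), i.val < n - 1 - k →
        P ⟨n - 1 - k, h⟩ i = dropLast 1 y i := by
      intro i k
      induction k with
      | zero => intro h _; exact congrFun (hP.last (by omega)) i
      | succ k ih =>
        intro h hk
        rw [hP.step (n - 1 - (k + 1)) (by omega) i (by omega)]
        have e : n - 1 - (k + 1) + 1 = n - 1 - k := by omega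
        simp only [e]
        exact ih (by omega) (by omega)
    funext j i
    unfold route
    split_ifs with hij
    · have e : j = ⟨n - 1 - (n - 1 - j.val), by omega⟩ := by
        apply Fin.ext; have := j.2; simp only; omega
      rw [e]
      exact down i _ _ (by have := j.2; omega)
    · exact up i j.val j.2 (by omega)
  · rintro rfl
    refine ⟨?_, ?_, ?_⟩
    · intro h; funext i; simp [route]
    · intro j h i hi
      have : (i.val < j) ↔ (i.val < j + 1) := by omega
      simp [route, this]
    · intro h; funext i; simp [route]

/-- The routes `R(u, v)` and `R(u', v')`, placed on one plane, share a switching element. -/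
def ShareSE {d n : ℕ} (u v u' v' : Word d n) : Prop :=
  ∃ j : Fin n, route u v j = route u' v' j

/-! ### States of the network `log_d(N, 0, m)`, and multicast requests -/

/-- A state of the network with `m` planes: `s v = some (u, p)` says that output `v` currently
receives from input `u` through plane `p`, and `s v = none` that output `v` is free. The request
currently held by an input `u` consists of `u` and all the outputs that receive from `u`. -/
abbrev State (d n m : ℕ) : Type := Word d n → Option (Word d n × Fin m)

/-- No two routes on one plane that belong to different requests share a switching element. -/
def CrosstalkFree {d n m : ℕ} (s : State d n m) : Prop :=
  ∀ (p : Fin m) (u v u' v' : Word d n),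
    s v = some (u, p) → s v' = some (u', p) → u ≠ u' → ¬ ShareSE u v u' v'

/-- `(a, B)` is a new multicast request in state `s`: the input `a` is free, and `B` is a nonempty
set of free outputs. -/
def IsNewRequest {d n m : ℕ} (s : State d n m) (a : Word d n) (B : Finset (Word d n)) : Prop :=
  (∀ (v : Word d n) (p : Fin m), s v ≠ some (a, p)) ∧ B.Nonempty ∧ ∀ b ∈ B, s b = none

/-- The state after the request `(a, B)` has been routed, the branch to `b ∈ B` through the
plane `ρ b`. -/
def State.connect {d n m : ℕ} (s : State d n m) (a : Word d n) (B : Finset (Word d n))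
    (ρ : Word d n → Fin m) : State d n m :=
  fun v => if v ∈ B then some (a, ρ v) else s v

/-- The state after the request held by input `a` has been released. -/
def State.release {d n m : ℕ} (s : State d n m) (a : Word d n) : State d n m :=
  fun v => (s v).filter (fun c => decide (c.1 ≠ a))

/-- A routing algorithm, as a restriction on the planes `ρ b` through which the branches `b ∈ B`
of a request `(a, B)` may be routed; among the permitted routings it chooses arbitrarily. -/
abbrev RoutingRule (d n m : ℕ) : Type :=
  Word d n → Finset (Word d n) → (Word d n → Fin m) → Prop

/-- The window algorithm with window size `d ^ t`: a window consists of all the outputs that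
share a given prefix of length `n - t`, and the outputs of a request that lie in one window are
all routed through one plane. -/
def windowRule (d n m t : ℕ) : RoutingRule d n m :=
  fun _ B ρ => ∀ b ∈ B, ∀ b' ∈ B, dropLast t b = dropLast t b' → ρ b = ρ b'

/-- The states that can arise from the idle network by successively routing new requests
according to the rule `A`, without crosstalk, and releasing existing requests. -/
inductive Reachable {d n m : ℕ} (A : RoutingRule d n m) : State d n m → Prop
  | idle : Reachable A (fun _ => none)
  | connect (s : State d n m) (a : Word d n) (B : Finset (Word d n)) (ρ : Word d n → Fin m) :
      Reachable A s → IsNewRequest s a B → A a B ρ → CrosstalkFree (s.connect a B ρ) →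
      Reachable A (s.connect a B ρ)
  | release (s : State d n m) (a : Word d n) : Reachable A s → Reachable A (s.release a)

/-- The network `log_d(d ^ n, 0, m)` is crosstalk-free wide-sense nonblocking under `A` (for
multicast requests without fanout restriction): as long as all requests have been routed according
to `A`, every new request can be routed according to `A` and without crosstalk, the existing
connections being left undisturbed. -/
def CrosstalkFreeWSNB {d n m : ℕ} (A : RoutingRule d n m) : Prop :=
  ∀ s : State d n m, Reachable A s →
    ∀ (a : Word d n) (B : Finset (Word d n)), IsNewRequest s a B →
      ∃ ρ : Word d n → Fin m, A a B ρ ∧ CrosstalkFree (s.connect a B ρ)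

end Multilog

namespace Multilog

/-! ### Counting strings -/

/-! Branches of one request never conflict with each other, so each window can be given a plane on
its own: it suffices that fewer than `m` planes are blocked for the branches from `a` into a window
`w` (`crosstalkFreeWSNB_of_blocked_lt`). Windows whose prefix first departs from `w` at index `i`
are met only in stages up to `i`, which leaves at most `d ^ (i + 1) - 1` competing inputs. Each of
these uses a single plane per window, and each of the `d ^ t` outputs at most one, so such a window
blocks at most the minimum of the two numbers (`card_blocked_outside_le`); summing over `i`
telescopes. Inside `w` at most `d ^ t - 1` planes are blocked. For `2 * t ≥ n + 2` a trade-off in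
the size of `B` improves this (`card_blocked_window_le_of_lt_two_mul`). -/

theorem card_agree {d l : ℕ} (w : Word d l) (p : Fin l → Prop) [DecidablePred p] :
    (Finset.univ.filter fun x : Word d l => ∀ i, p i → x i = w i).card
      = d ^ (Finset.univ.filter fun i => ¬ p i).card := by
  have h : (Finset.univ.filter fun x : Word d l => ∀ i, p i → x i = w i)
      = Fintype.piFinset fun i => if p i then {w i} else Finset.univ := by
    ext x
    simp only [Finset.mem_filter, Finset.mem_univ, true_and, Fintype.mem_piFinset]
    refine forall_congr' fun i => ?_
    split_ifs with hi <;> simp [hi]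
  rw [h, Fintype.card_piFinset, ← Finset.prod_const, Finset.prod_filter]
  refine Finset.prod_congr rfl fun i _ => ?_
  by_cases hi : p i <;> simp [hi]

theorem card_filter_val (l : ℕ) (q : ℕ → Prop) [DecidablePred q] :
    (Finset.univ.filter fun i : Fin l => q i.val).card = ((Finset.range l).filter q).card := by
  rw [← Finset.card_image_of_injective _ Fin.val_injective]
  congr 1
  ext i
  simp only [Finset.mem_image, Finset.mem_filter, Finset.mem_univ, true_and, Finset.mem_range]
  constructor
  · rintro ⟨j, hj, rfl⟩
    exact ⟨j.2, hj⟩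
  · rintro ⟨hi, hq⟩
    exact ⟨⟨i, hi⟩, hq, rfl⟩

/-- The strings with the same first `k` symbols as `w`. -/
def prefixClass {d l : ℕ} (w : Word d l) (k : ℕ) : Finset (Word d l) :=
  Finset.univ.filter fun x => ∀ i : Fin l, i.val < k → x i = w i

theorem card_prefixClass {d l : ℕ} (w : Word d l) (k : ℕ) :
    (prefixClass w k).card = d ^ (l - k) := by
  rw [prefixClass, card_agree w fun i => i.val < k]
  congr 1
  rw [card_filter_val l fun i => ¬ i < k, ← Nat.card_Ico]
  congr 1
  ext i
  simp only [Finset.mem_filter, Finset.mem_range, Finset.mem_Ico]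
  omega

theorem card_dropLast_fiber {d l : ℕ} (w : Word d l) {k : ℕ} (hk : k ≤ l) :
    (Finset.univ.filter fun x : Word d l => dropLast k x = dropLast k w).card = d ^ k := by
  have h : (Finset.univ.filter fun x : Word d l => dropLast k x = dropLast k w)
      = prefixClass w (l - k) := by
    ext x
    simp only [prefixClass, Finset.mem_filter, Finset.mem_univ, true_and]
    constructor
    · intro h i hi
      exact congrFun h ⟨i, hi⟩
    · intro h
      funext i
      exact h _ i.2
  rw [h, card_prefixClass, Nat.sub_sub_self hk]

/-- The inputs other than `a` whose routes can meet a route from `a` in one of the first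
`j + 1` stages. -/
def rivals {d n : ℕ} (a : Word d n) (j : ℕ) : Finset (Word d n) :=
  (Finset.univ.filter fun u => ∀ i : Fin n, (j ≤ i.val ∧ i.val + 1 < n) → u i = a i).erase a

/-- The free symbols are the first `j` and also the last one, which no switching element label
records. -/
theorem card_rivals {d n : ℕ} (a : Word d n) {j : ℕ} (hj : j < n) :
    (rivals a j).card = d ^ (j + 1) - 1 := by
  rw [rivals, Finset.card_erase_of_mem (by simp),
    card_agree a fun i => j ≤ i.val ∧ i.val + 1 < n]
  congr 2
  rw [card_filter_val n fun i => ¬ (j ≤ i ∧ i + 1 < n)]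
  have h : ((Finset.range n).filter fun i => ¬ (j ≤ i ∧ i + 1 < n))
      = insert (n - 1) (Finset.range j) := by
    ext i
    simp only [Finset.mem_filter, Finset.mem_range, Finset.mem_insert]
    omega
  rw [h, Finset.card_insert_of_notMem (by simp only [Finset.mem_range]; omega),
    Finset.card_range]

theorem rivals_mono {d n : ℕ} (a : Word d n) {i j : ℕ} (h : i ≤ j) : rivals a i ⊆ rivals a j := by
  intro u
  simp only [rivals, Finset.mem_erase, Finset.mem_filter, Finset.mem_univ, true_and]
  exact fun hu => ⟨hu.1, fun k hk => hu.2 k ⟨h.trans hk.1, hk.2⟩⟩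

/-- After stage `i` the labels contain the output symbol at `i`, where `v` and `b` differ. So the
routes meet no later, while all input symbols from `i` up to the last but one are still in the
label. -/
theorem mem_rivals_of_shareSE {d n : ℕ} {a b u v : Word d n} (h : ShareSE u v a b) (hu : u ≠ a)
    {i : Fin n} (hv : v i ≠ b i) : u ∈ rivals a i := by
  obtain ⟨j, hj⟩ := h
  have hji : j.val ≤ i.val := by
    by_contra hlt
    have := congrFun hj ⟨i.val, by omega⟩
    simp only [route, if_pos (not_le.mp hlt)] at this
    exact hv this
  simp only [rivals, Finset.mem_erase, Finset.mem_filter, Finset.mem_univ, true_and]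
  refine ⟨hu, fun k hk => ?_⟩
  have := congrFun hj ⟨k.val, by omega⟩
  simp only [route, if_neg (not_lt.mpr (hji.trans hk.1))] at this
  exact this

/-! ### Planes in use -/

/-- The planes that carry a connection from an input in `U` to an output in `V`. -/
def planes {d n m : ℕ} (s : State d n m) (U V : Finset (Word d n)) : Finset (Fin m) :=
  Finset.univ.filter fun p => ∃ u ∈ U, ∃ v ∈ V, s v = some (u, p)

theorem mem_planes {d n m : ℕ} {s : State d n m} {U V : Finset (Word d n)} {p : Fin m} :
    p ∈ planes s U V ↔ ∃ u ∈ U, ∃ v ∈ V, s v = some (u, p) := by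
  simp [planes]

theorem card_planes_le_outputs {d n m : ℕ} (s : State d n m) (U V : Finset (Word d n)) :
    (planes s U V).card ≤ V.card := by
  refine Finset.card_le_card_of_forall_subsingleton (fun p v => ∃ u, s v = some (u, p)) ?_ ?_
  · intro p hp
    obtain ⟨u, -, v, hv, h⟩ := mem_planes.mp hp
    exact ⟨v, hv, u, h⟩
  · rintro v - p ⟨-, u, h⟩ p' ⟨-, u', h'⟩
    have := h.symm.trans h'
    simp only [Option.some.injEq, Prod.mk.injEq] at this
    exact this.2

/-- All connections from one input to one window use the same plane. -/
def Uniform {d n m : ℕ} (t : ℕ) (s : State d n m) : Prop :=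
  ∀ (u v v' : Word d n) (p p' : Fin m), s v = some (u, p) → s v' = some (u, p') →
    dropLast t v = dropLast t v' → p = p'

/-- The outputs of a window. -/
def window {d n : ℕ} (t : ℕ) (w : Word d (n - t)) : Finset (Word d n) :=
  Finset.univ.filter fun v => dropLast t v = w

theorem mem_window {d n t : ℕ} {w : Word d (n - t)} {v : Word d n} :
    v ∈ window t w ↔ dropLast t v = w := by
  simp [window]

theorem card_window_le {d n t : ℕ} (ht : t ≤ n) (w : Word d (n - t)) :
    (window t w).card ≤ d ^ t := by
  rcases (window t w).eq_empty_or_nonempty with h | ⟨v, hv⟩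
  · simp [h]
  · rw [← card_dropLast_fiber v ht, window, mem_window.mp hv]

/-- This is where the window rule pays off: multicast fanout inside a window costs an input only one
plane. -/
theorem card_planes_le_inputs {d n m t : ℕ} {s : State d n m} (hs : Uniform t s)
    (U : Finset (Word d n)) (w : Word d (n - t)) :
    (planes s U (window t w)).card ≤ U.card := by
  refine Finset.card_le_card_of_forall_subsingleton
    (fun p u => ∃ v ∈ window t w, s v = some (u, p)) ?_ ?_
  · intro p hp
    obtain ⟨u, hu, v, hv, h⟩ := mem_planes.mp hp
    exact ⟨u, hu, v, hv, h⟩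
  · rintro u - p ⟨-, v, hv, h⟩ p' ⟨-, v', hv', h'⟩
    exact hs u v v' p p' h h' ((mem_window.mp hv).trans (mem_window.mp hv').symm)

/-- The strings whose first symbol different from that of `w` is the one with index `i`. -/
def level {d l : ℕ} (w : Word d l) (i : ℕ) : Finset (Word d l) :=
  prefixClass w i \ prefixClass w (i + 1)

theorem card_level {d l : ℕ} (w : Word d l) (i : ℕ) :
    (level w i).card = d ^ (l - i) - d ^ (l - (i + 1)) := by
  rw [level, Finset.card_sdiff_of_subset, card_prefixClass, card_prefixClass]
  intro x
  simp only [prefixClass, Finset.mem_filter, Finset.mem_univ, true_and]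
  exact fun h k hk => h k (by omega)

theorem exists_mem_level {d l : ℕ} {w x : Word d l} (h : x ≠ w) :
    ∃ i : Fin l, x ∈ level w i ∧ x i ≠ w i := by
  classical
  have hex : ∃ k, ∃ hk : k < l, x ⟨k, hk⟩ ≠ w ⟨k, hk⟩ := by
    by_contra hcon
    push Not at hcon
    exact h (funext fun i => hcon i i.2)
  obtain ⟨hk, hne⟩ := Nat.find_spec hex
  refine ⟨⟨Nat.find hex, hk⟩, ?_, hne⟩
  simp only [level, prefixClass, Finset.mem_sdiff, Finset.mem_filter, Finset.mem_univ, true_and]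
  refine ⟨fun i hi => ?_, fun hall => hne (hall _ (Nat.lt_succ_self _))⟩
  by_contra hcon
  exact Nat.find_min hex hi ⟨i.2, hcon⟩

/-- The planes on which a connection from `a` to an output in `B` would meet a connection from
another input to an output in `V`. -/
noncomputable def blocked {d n m : ℕ} (s : State d n m) (a : Word d n) (B V : Finset (Word d n)) :
    Finset (Fin m) := by
  classical
  exact Finset.univ.filter fun p =>
    ∃ u ≠ a, ∃ v ∈ V, ∃ b ∈ B, s v = some (u, p) ∧ ShareSE u v a b

theorem mem_blocked {d n m : ℕ} {s : State d n m} {a : Word d n} {B V : Finset (Word d n)}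
    {p : Fin m} : p ∈ blocked s a B V ↔
      ∃ u ≠ a, ∃ v ∈ V, ∃ b ∈ B, s v = some (u, p) ∧ ShareSE u v a b := by
  simp [blocked]

theorem card_blocked_outside_le {d n m t : ℕ} {s : State d n m} (hs : Uniform t s) (ht : t ≤ n)
    (a : Word d n) (w : Word d (n - t)) {B : Finset (Word d n)} (hB : B ⊆ window t w) :
    (blocked s a B (window t w)ᶜ).card ≤ ∑ i ∈ Finset.range (n - t),
      (d ^ (n - t - i) - d ^ (n - t - (i + 1))) * min (d ^ t) (d ^ (i + 1) - 1) := by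
  have hsub : blocked s a B (window t w)ᶜ ⊆ (Finset.range (n - t)).biUnion fun i =>
      (level w i).biUnion fun w' => planes s (rivals a i) (window t w') := by
    intro p hp
    obtain ⟨u, hu, v, hv, b, hb, hsv, hsh⟩ := mem_blocked.mp hp
    rw [Finset.mem_compl, mem_window] at hv
    obtain ⟨i, hi, hne⟩ := exists_mem_level hv
    rw [← mem_window.mp (hB hb)] at hne
    simp only [Finset.mem_biUnion, Finset.mem_range]
    refine ⟨i, i.2, _, hi, mem_planes.mpr ⟨u, ?_, v, mem_window.mpr rfl, hsv⟩⟩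
    exact mem_rivals_of_shareSE (i := Fin.castLE (Nat.sub_le n t) i) hsh hu hne
  refine (Finset.card_le_card hsub).trans (Finset.card_biUnion_le.trans ?_)
  refine Finset.sum_le_sum fun i hi => ?_
  rw [← card_level w i]
  refine Finset.card_biUnion_le_card_mul _ _ _ fun w' _ => le_min ?_ ?_
  · exact (card_planes_le_outputs s _ _).trans (card_window_le ht w')
  · rw [← card_rivals a (show i < n by have := Finset.mem_range.mp hi; omega)]
    exact card_planes_le_inputs hs _ w'

/-- The outputs in `B` are free, so only the rest of the window can block, one plane per output. -/
theorem card_blocked_window_le {d n m t : ℕ} {s : State d n m} (ht : t ≤ n)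
    (a : Word d n) (w : Word d (n - t)) {B : Finset (Word d n)} (hB : B ⊆ window t w)
    (hfree : ∀ b ∈ B, s b = none) :
    (blocked s a B (window t w)).card + B.card ≤ d ^ t := by
  have hsub : blocked s a B (window t w) ⊆ planes s Finset.univ (window t w \ B) := by
    intro p hp
    obtain ⟨u, hu, v, hv, b, hb, hsv, hsh⟩ := mem_blocked.mp hp
    refine mem_planes.mpr ⟨u, Finset.mem_univ u, v, Finset.mem_sdiff.mpr ⟨hv, fun hvB => ?_⟩, hsv⟩
    simp [hfree v hvB] at hsv
  have h1 := (Finset.card_le_card hsub).trans (card_planes_le_outputs s _ _)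
  rw [Finset.card_sdiff_of_subset hB] at h1
  have h2 := card_window_le ht w
  have h3 := Finset.card_le_card hB
  omega

/-- An input meeting a connection from `a` to `B` either is one of the few rivals of `a` in the
first `r` stages, or sends to an output that shares `r` symbols with an element of `B`. -/
theorem exists_card_blocked_window_le {d n m t : ℕ} {s : State d n m} (hs : Uniform t s) {k r : ℕ}
    (hr : k + r = n) (hr1 : 1 ≤ r) (a : Word d n) (w : Word d (n - t)) {B : Finset (Word d n)}
    (hfree : ∀ b ∈ B, s b = none) :
    ∃ c ≤ B.card, (blocked s a B (window t w)).card + B.card ≤ c * d ^ k + (d ^ r - 1) := by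
  classical
  set C : Finset (Word d (n - k)) := B.image (dropLast k) with hC
  set V := Finset.univ.filter fun v : Word d n => dropLast k v ∈ C with hV
  have hBV : B ⊆ V := fun b hb => by
    simp only [hV, Finset.mem_filter, Finset.mem_univ, true_and]
    exact Finset.mem_image_of_mem _ hb
  have hVcard : V.card ≤ C.card * d ^ k := by
    have : V ⊆ C.biUnion (window k) := fun v hv => by
      simpa [hV, mem_window] using hv
    exact (Finset.card_le_card this).trans
      (Finset.card_biUnion_le_card_mul _ _ _ fun w' _ => card_window_le (by omega) w')
  have hsub : blocked s a B (window t w) ⊆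
      planes s Finset.univ (V \ B) ∪ planes s (rivals a (r - 1)) (window t w) := by
    intro p hp
    obtain ⟨u, hu, v, hv, b, hb, hsv, hsh⟩ := mem_blocked.mp hp
    rw [Finset.mem_union, mem_planes, mem_planes]
    by_cases hvV : v ∈ V
    · refine Or.inl ⟨u, Finset.mem_univ u, v, Finset.mem_sdiff.mpr ⟨hvV, fun hvB => ?_⟩, hsv⟩
      simp [hfree v hvB] at hsv
    -- Here `v` and `b` already differ at an index below `r`, so the routes meet in the first `r`
    -- stages.
    · refine Or.inr ⟨u, ?_, v, hv, hsv⟩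
      have hne : dropLast k v ≠ dropLast k b := fun h => hvV (by
        simp only [hV, Finset.mem_filter, Finset.mem_univ, true_and, h]
        exact Finset.mem_image_of_mem _ hb)
      obtain ⟨i, -, hi⟩ := exists_mem_level hne
      have hi2 := i.2
      exact rivals_mono a (by simp only [Fin.val_castLE]; omega)
        (mem_rivals_of_shareSE (i := Fin.castLE (Nat.sub_le n k) i) hsh hu hi)
  refine ⟨C.card, Finset.card_image_le, ?_⟩
  have h1 := (Finset.card_le_card hsub).trans (Finset.card_union_le _ _)
  have h2 := card_planes_le_outputs s Finset.univ (V \ B)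
  have h3 := card_planes_le_inputs hs (rivals a (r - 1)) w
  rw [card_rivals a (by omega), Nat.sub_add_cancel hr1] at h3
  rw [Finset.card_sdiff_of_subset hBV] at h2
  have h4 := Finset.card_le_card hBV
  omega

/-! ### The window algorithm -/

theorem Reachable.crosstalkFree {d n m : ℕ} {A : RoutingRule d n m} {s : State d n m}
    (h : Reachable A s) : CrosstalkFree s := by
  induction h with
  | idle => intro p u v u' v' h; simp at h
  | connect s a B ρ _ _ _ h _ => exact h
  | release s a _ ih =>
    intro p u v u' v' h h'
    simp only [State.release, Option.filter_eq_some_iff] at h h'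
    exact ih p u v u' v' h.1 h'.1

/-- A new request starts at a free input, so its branches never mix with older connections of that
input. -/
theorem Reachable.uniform {d n m t : ℕ} {s : State d n m}
    (h : Reachable (windowRule d n m t) s) : Uniform t s := by
  induction h with
  | idle => intro u v v' p p' h; simp at h
  | connect s a B ρ _ hnew hρ _ ih =>
    intro u v v' p p' h h' hw
    simp only [State.connect] at h h'
    split_ifs at h h' with hv hv' hv'
    · simp only [Option.some.injEq, Prod.mk.injEq] at h h'
      rw [← h.2, ← h'.2]
      exact hρ v hv v' hv' hw
    · simp only [Option.some.injEq, Prod.mk.injEq] at h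
      exact absurd h' (h.1 ▸ hnew.1 v' p')
    · simp only [Option.some.injEq, Prod.mk.injEq] at h'
      exact absurd h (h'.1 ▸ hnew.1 v p)
    · exact ih u v v' p p' h h' hw
  | release s a _ ih =>
    intro u v v' p p' h h'
    simp only [State.release, Option.filter_eq_some_iff] at h h'
    exact ih u v v' p p' h.1 h'.1

theorem ShareSE.symm {d n : ℕ} {u v u' v' : Word d n} (h : ShareSE u v u' v') :
    ShareSE u' v' u v := by
  obtain ⟨j, hj⟩ := h
  exact ⟨j, hj.symm⟩

/-- It suffices that the branches into a single window never find all planes blocked. -/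
theorem crosstalkFreeWSNB_of_blocked_lt {d n m t : ℕ}
    (H : ∀ s : State d n m, Uniform t s → ∀ (a : Word d n) (w : Word d (n - t))
      (B : Finset (Word d n)), B.Nonempty → B ⊆ window t w → (∀ b ∈ B, s b = none) →
      (blocked s a B (window t w)).card + (blocked s a B (window t w)ᶜ).card < m) :
    CrosstalkFreeWSNB (windowRule d n m t) := by
  intro s hs a B hnew
  have key : ∀ w : Word d (n - t), (B ∩ window t w).Nonempty → ∃ p : Fin m,
      ∀ b ∈ B ∩ window t w, ∀ u ≠ a, ∀ v, s v = some (u, p) → ¬ ShareSE u v a b := by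
    intro w hne
    have hlt := H s hs.uniform a w _ hne Finset.inter_subset_right
      fun b hb => hnew.2.2 b (Finset.mem_of_mem_inter_left hb)
    obtain ⟨p, hp⟩ : ∃ p, p ∉ blocked s a (B ∩ window t w) (window t w) ∪
        blocked s a (B ∩ window t w) (window t w)ᶜ := by
      by_contra hcon
      push Not at hcon
      have := (Finset.card_union_le _ _).trans_lt hlt
      rw [Finset.eq_univ_iff_forall.mpr hcon, Finset.card_univ, Fintype.card_fin] at this
      exact lt_irrefl _ this
    refine ⟨p, fun b hb u hu v hsv hsh => hp ?_⟩
    rw [Finset.mem_union, mem_blocked, mem_blocked]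
    by_cases hv : v ∈ window t w
    · exact Or.inl ⟨u, hu, v, hv, b, hb, hsv, hsh⟩
    · exact Or.inr ⟨u, hu, v, Finset.mem_compl.mpr hv, b, hb, hsv, hsh⟩
  obtain ⟨b₀, hb₀⟩ := hnew.2.1
  have : Nonempty (Fin m) :=
    ⟨(key (dropLast t b₀) ⟨b₀, Finset.mem_inter.mpr ⟨hb₀, mem_window.mpr rfl⟩⟩).choose⟩
  have key' : ∀ w : Word d (n - t), ∃ p : Fin m,
      ∀ b ∈ B ∩ window t w, ∀ u ≠ a, ∀ v, s v = some (u, p) → ¬ ShareSE u v a b := by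
    intro w
    rcases (B ∩ window t w).eq_empty_or_nonempty with h | h
    -- Windows that miss `B` get a dummy plane.
    · exact ⟨Classical.arbitrary _, by simp [h]⟩
    · exact key w h
  choose σ hσ using key'
  refine ⟨fun b => σ (dropLast t b), fun b _ b' _ h => by simp only [h], ?_⟩
  have hmem : ∀ b ∈ B, b ∈ B ∩ window t (dropLast t b) := fun b hb =>
    Finset.mem_inter.mpr ⟨hb, mem_window.mpr rfl⟩
  intro p u v u' v' h h' hne
  simp only [State.connect] at h h'
  split_ifs at h h' with hv hv' hv'
  · simp only [Option.some.injEq, Prod.mk.injEq] at h h'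
    exact absurd (h.1.symm.trans h'.1) hne
  · simp only [Option.some.injEq, Prod.mk.injEq] at h
    obtain ⟨rfl, rfl⟩ := h
    exact fun hsh => hσ _ v (hmem v hv) u' hne.symm v' h' hsh.symm
  · simp only [Option.some.injEq, Prod.mk.injEq] at h'
    obtain ⟨rfl, rfl⟩ := h'
    exact hσ _ v' (hmem v' hv') u hne v h
  · exact hs.crosstalkFree p u v u' v' h h' hne

/-! ### Summing over the levels -/

/-- With the input bound, each term is the constant `d ^ l * (d - 1)` minus a telescoping
difference. -/
theorem sum_levels_le_of_inputs {d t l k : ℕ} (hd : 1 ≤ d) (hk : k ≤ l) :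
    ((∑ i ∈ Finset.range k, (d ^ (l - i) - d ^ (l - (i + 1))) * min (d ^ t) (d ^ (i + 1) - 1) :
      ℕ) : ℝ) ≤ k * (d : ℝ) ^ l * (d - 1) - (d : ℝ) ^ l + (d : ℝ) ^ (l - k) := by
  induction k with
  | zero => simp
  | succ k ih =>
    have h1 : ((d ^ (l - k) - d ^ (l - (k + 1)) : ℕ) : ℝ)
        = (d : ℝ) ^ (l - k) - (d : ℝ) ^ (l - (k + 1)) := by
      rw [Nat.cast_sub (Nat.pow_le_pow_right hd (by omega))]; push_cast; ring
    have h2 : ((min (d ^ t) (d ^ (k + 1) - 1) : ℕ) : ℝ) ≤ (d : ℝ) ^ (k + 1) - 1 := by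
      have : ((d ^ (k + 1) - 1 : ℕ) : ℝ) = (d : ℝ) ^ (k + 1) - 1 := by
        rw [Nat.cast_sub (Nat.one_le_pow _ _ hd)]; push_cast; ring
      rw [← this]
      exact_mod_cast min_le_right _ _
    have h3 : (d : ℝ) ^ (l - k) = (d : ℝ) ^ (l - (k + 1)) * d := by
      rw [← pow_succ]; congr 1; omega
    have h4 : (d : ℝ) ^ l = (d : ℝ) ^ (l - (k + 1)) * (d : ℝ) ^ (k + 1) := by
      rw [← pow_add]; congr 1; omega
    have h5 := mul_le_mul_of_nonneg_left h2 (Nat.cast_nonneg (α := ℝ)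
      (d ^ (l - k) - d ^ (l - (k + 1))))
    have h6 := ih (by omega)
    rw [Finset.sum_range_succ, Nat.cast_add, Nat.cast_mul]
    refine (add_le_add h6 h5).trans (le_of_eq ?_)
    rw [h1, h3, h4]
    push_cast
    ring

theorem sum_levels_le_of_outputs {d t l k : ℕ} (hd : 1 ≤ d) (hk : t + k ≤ l) :
    ((∑ i ∈ Finset.range k, (d ^ (l - (t + i)) - d ^ (l - (t + i + 1))) *
        min (d ^ t) (d ^ (t + i + 1) - 1) : ℕ) : ℝ)
      ≤ (d : ℝ) ^ l - (d : ℝ) ^ (l - (t + k)) * (d : ℝ) ^ t := by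
  induction k with
  | zero =>
    rw [add_zero, ← pow_add, Nat.sub_add_cancel (by omega)]
    simp
  | succ k ih =>
    have h1 : ((d ^ (l - (t + k)) - d ^ (l - (t + k + 1)) : ℕ) : ℝ)
        = (d : ℝ) ^ (l - (t + k)) - (d : ℝ) ^ (l - (t + k + 1)) := by
      rw [Nat.cast_sub (Nat.pow_le_pow_right hd (by omega))]; push_cast; ring
    have h2 : ((min (d ^ t) (d ^ (t + k + 1) - 1) : ℕ) : ℝ) ≤ (d : ℝ) ^ t := by
      exact_mod_cast min_le_left _ _
    have h5 := mul_le_mul_of_nonneg_left h2 (Nat.cast_nonneg (α := ℝ)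
      (d ^ (l - (t + k)) - d ^ (l - (t + k + 1))))
    have h6 := ih (by omega)
    rw [Finset.sum_range_succ, Nat.cast_add, Nat.cast_mul]
    refine (add_le_add h6 h5).trans (le_of_eq ?_)
    rw [h1, add_assoc t k 1]
    ring

/-- The sum is split at `i = t`, where the output bound `d ^ t` takes over from `d ^ (i + 1) - 1`.
The final `- d ^ t` offsets the contribution of the window itself. -/
theorem sum_levels_le_of_two_mul_lt {d n t : ℕ} (hd : 1 ≤ d) (h : 2 * t < n) :
    ((∑ i ∈ Finset.range (n - t),
      (d ^ (n - t - i) - d ^ (n - t - (i + 1))) * min (d ^ t) (d ^ (i + 1) - 1) : ℕ) : ℝ)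
      ≤ (d : ℝ) ^ (n - 2 * t) + t * (d : ℝ) ^ (n - t) * (d - 1) - (d : ℝ) ^ t := by
  obtain ⟨k, hk⟩ : ∃ k, n - t = t + k := ⟨n - 2 * t, by omega⟩
  have h1 := sum_levels_le_of_inputs (t := t) (l := t + k) (k := t) hd (by omega)
  have h2 := sum_levels_le_of_outputs (t := t) (l := t + k) (k := k) hd le_rfl
  rw [hk, Finset.sum_range_add, Nat.cast_add]
  refine (add_le_add h1 h2).trans (le_of_eq ?_)
  rw [show n - 2 * t = k by omega, Nat.add_sub_cancel_left, Nat.sub_self]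
  ring

theorem sum_levels_le {d n t : ℕ} (hd : 1 ≤ d) (ht : t ≤ n) :
    ((∑ i ∈ Finset.range (n - t),
      (d ^ (n - t - i) - d ^ (n - t - (i + 1))) * min (d ^ t) (d ^ (i + 1) - 1) : ℕ) : ℝ)
      ≤ (d : ℝ) ^ (n - t) * (((n : ℝ) - t) * (d - 1) - 1) + 1 := by
  refine (sum_levels_le_of_inputs (t := t) hd le_rfl).trans (le_of_eq ?_)
  rw [Nat.cast_sub ht, Nat.sub_self]
  ring

/-- Inside one window, for `2 * t ≥ n + 2`, a large `B` leaves few outputs to other inputs, while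
a small `B` shares a prefix of length `t - 1` with few outputs. -/
theorem card_blocked_window_le_of_lt_two_mul {d n m t : ℕ} {s : State d n m} (hd : 1 ≤ d)
    (ht : t ≤ n) (hs : Uniform t s) (h : n + 2 ≤ 2 * t) (a : Word d n) (w : Word d (n - t))
    {B : Finset (Word d n)} (hB : B ⊆ window t w) (hfree : ∀ b ∈ B, s b = none) :
    ((blocked s a B (window t w)).card : ℝ) + 1
      ≤ (d : ℝ) ^ t - (d : ℝ) ^ (2 * t - n - 2) * (d - 1) := by
  -- The threshold `q` for the size of `B` solves `q * d ^ (n - t + 1) + d ^ (t - 1) = d ^ t`, which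
  -- makes both cases give the same bound.
  obtain ⟨q, hq⟩ : ∃ q : ℕ, q = d ^ (2 * t - n - 2) * (d - 1) := ⟨_, rfl⟩
  have hqR : (q : ℝ) = (d : ℝ) ^ (2 * t - n - 2) * (d - 1) := by
    rw [hq, Nat.cast_mul, Nat.cast_sub hd]; push_cast; ring
  rw [← hqR]
  by_cases hBq : q + 1 ≤ B.card
  · have h1 := card_blocked_window_le ht a w hB hfree
    have h2 : (blocked s a B (window t w)).card + (q + 1) ≤ d ^ t := by omega
    have h3 : ((blocked s a B (window t w)).card : ℝ) + (q + 1) ≤ (d : ℝ) ^ t := by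
      exact_mod_cast h2
    linarith
  · obtain ⟨c, hc, h1⟩ := exists_card_blocked_window_le (k := n - t + 1) (r := t - 1) hs
      (by omega) (by omega) a w hfree
    have h2 : (blocked s a B (window t w)).card + B.card + 1 ≤
        c * d ^ (n - t + 1) + d ^ (t - 1) := by
      have := Nat.one_le_pow (t - 1) d hd
      omega
    have h3 : ((blocked s a B (window t w)).card : ℝ) + B.card + 1 ≤
        c * (d : ℝ) ^ (n - t + 1) + (d : ℝ) ^ (t - 1) := by
      exact_mod_cast h2
    have hcB : (c : ℝ) ≤ B.card := by exact_mod_cast hc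
    have hcq : (c : ℝ) ≤ q := by
      have : c ≤ q := by omega
      exact_mod_cast this
    have hd1 : (1 : ℝ) ≤ (d : ℝ) ^ (n - t + 1) := one_le_pow₀ (by exact_mod_cast hd)
    -- Replacing `B.card` by `c` leaves `c * (d ^ (n - t + 1) - 1)`, monotone in `c`, so `c` may be
    -- raised to `q`.
    have h4 := mul_le_mul_of_nonneg_right hcq (sub_nonneg.mpr hd1)
    have h5 : (q : ℝ) * (d : ℝ) ^ (n - t + 1) = (d : ℝ) ^ t - (d : ℝ) ^ (t - 1) := by
      have e1 : (d : ℝ) ^ (2 * t - n - 2) * (d : ℝ) ^ (n - t + 1) = (d : ℝ) ^ (t - 1) := by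
        rw [← pow_add]; congr 1; omega
      have e2 : (d : ℝ) ^ t = (d : ℝ) ^ (t - 1) * d := by
        rw [← pow_succ]; congr 1; omega
      rw [hqR, e2, ← e1]
      ring
    linarith

end Multilog

theorem mainTheorem11 (d n t m : ℕ) (hd : 1 ≤ d) (hn : 1 ≤ n) (ht : t ≤ n) :
    (2 * t < n →
      (d : ℝ) ^ (n - 2 * t) + (t : ℝ) * (d : ℝ) ^ (n - t) * ((d : ℝ) - 1) ≤ (m : ℝ) →
      Multilog.CrosstalkFreeWSNB (Multilog.windowRule d n m t)) ∧
    (2 * t = n →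
      (d : ℝ) ^ (n - t) * (((n : ℝ) - (t : ℝ)) * ((d : ℝ) - 1) - 1) + (d : ℝ) ^ t + 1 ≤ (m : ℝ) →
      Multilog.CrosstalkFreeWSNB (Multilog.windowRule d n m t)) ∧
    (n < 2 * t →
      (d : ℝ) ^ (n - t) * (((n : ℝ) - (t : ℝ)) * ((d : ℝ) - 1) - 1) + (d : ℝ) ^ t
          - (d : ℝ) ^ (2 * (t : ℤ) - (n : ℤ) - 2) * ((d : ℝ) - 1) + 1 ≤ (m : ℝ) →
      Multilog.CrosstalkFreeWSNB (Multilog.windowRule d n m t)) := by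
  have hwin : ∀ (s : Multilog.State d n m) (a : Multilog.Word d n) (w : Multilog.Word d (n - t))
      (B : Finset (Multilog.Word d n)), B.Nonempty → B ⊆ Multilog.window t w →
      (∀ b ∈ B, s b = none) →
      ((Multilog.blocked s a B (Multilog.window t w)).card : ℝ) + 1 ≤ (d : ℝ) ^ t := by
    intro s a w B hne hB hfree
    have h1 := Multilog.card_blocked_window_le ht a w hB hfree
    have h2 : (Multilog.blocked s a B (Multilog.window t w)).card + 1 ≤ d ^ t := by
      have := hne.card_pos
      omega
    exact_mod_cast h2
  refine ⟨fun h hm => ?_, fun h hm => ?_, fun h hm => ?_⟩ <;>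
    refine Multilog.crosstalkFreeWSNB_of_blocked_lt fun s hs a w B hne hB hfree => ?_ <;>
    have hout := Nat.cast_le (α := ℝ).mpr (Multilog.card_blocked_outside_le hs ht a w hB) <;>
    have hin := hwin s a w B hne hB hfree <;>
    rw [← Nat.cast_lt (α := ℝ), Nat.cast_add]
  · have := Multilog.sum_levels_le_of_two_mul_lt hd h
    linarith
  · have := Multilog.sum_levels_le hd ht
    linarith
  · have hsum := Multilog.sum_levels_le hd ht
    -- For `2 * t = n + 1` the subtracted term is `(d - 1) / d < 1`, less than the slack of one
    -- plane, so the plain window bound suffices.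
    rcases (show n + 1 = 2 * t ∨ n + 2 ≤ 2 * t by omega) with h2 | h2
    · have hd0 : (0 : ℝ) < d := by exact_mod_cast hd
      have he : (2 * (t : ℤ) - (n : ℤ) - 2) = -1 := by omega
      have hlt : (d : ℝ) ^ (-1 : ℤ) * ((d : ℝ) - 1) < 1 := by
        rw [zpow_neg_one, mul_sub, inv_mul_cancel₀ hd0.ne']
        have := inv_pos.mpr hd0
        linarith
      rw [he] at hm
      linarith
    · have hin' := Multilog.card_blocked_window_le_of_lt_two_mul hd ht hs h2 a w hB hfree
      have he : (2 * (t : ℤ) - (n : ℤ) - 2) = ((2 * t - n - 2 : ℕ) : ℤ) := by omega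
      rw [he, zpow_natCast] at hm
      linarith
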